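/- Let $n,m,k$ be nonnegative integers and let $\mathcal M\in\{0,*,?\}^{n\times m}$ be a pattern matrix, where $0$ marks a fixed zero entry, $*$ an unknown generic entry and $?$ a missing entry. Let $\Omega_0,\Omega_*,\Omega_?$ be the sets of positions of the three symbols, and let $$\mathcal P(\mathcal M)=\{M\in\mathbb C^{n\times m}: M_{ij}=0\text{ for all }(i,j)\in\Omega_0\cup\Omega_?\}$$ be the set of realizations of $\mathcal M$, which is identified with $\mathbb C^{\Omega_*}$ through the values of the $*$ entries. For $M\in\mathcal P(\mathcal M)$ say that LRMC$(M,k)$ is feasible if there is a matrix $X\in\mathbb C^{n\times m}$ with $X_{ij}=M_{ij}$ for all $(i,j)\in\Omega_0\cup\Omega_*$ and $\operatorname{rank}X\le n-k$; otherwise it is infeasible. Here "for almost all $M\in\mathcal P(\mathcal M)$" means for all $M$ outside a set of Lebesgue measure zero in $\mathbb C^{\Omega_*}$. Then feasibility is a generic property on $\mathcal P(\mathcal M)$: exactly one of the following holds. Either for almost all $M\in\mathcal P(\mathcal M)$, LRMC$(M,k)$ is feasible, or for almost all $M\in\mathcal P(\mathcal M)$, LRMC$(M,k)$ is infeasible.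 -/

import Mathlib

open MeasureTheory

namespace LRMC

/-- The three symbols of a pattern matrix: `zero` is a fixed zero entry (`0`), `star` an unknown
generic entry (`*`), and `missing` an unspecified entry (`?`). -/
inductive PatternSymbol where
  | zero
  | star
  | missing
  deriving DecidableEq

/-- Pattern matrices in `{0,*,?}^{n×m}`. -/
abbrev Pattern (n m : ℕ) := Matrix (Fin n) (Fin m) PatternSymbol

namespace Pattern

variable {n m : ℕ}

/-- The positions of the `0` entries. -/
def zeroSet (P : Pattern n m) : Set (Fin n × Fin m) := {e | P e.1 e.2 = PatternSymbol.zero}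

/-- The positions of the `*` entries. -/
def starSet (P : Pattern n m) : Set (Fin n × Fin m) := {e | P e.1 e.2 = PatternSymbol.star}

/-- The positions of the `?` entries. -/
def missingSet (P : Pattern n m) : Set (Fin n × Fin m) := {e | P e.1 e.2 = PatternSymbol.missing}

/-- The positions of the observed entries, i.e. of the `0` and `*` entries. -/
def observedSet (P : Pattern n m) : Set (Fin n × Fin m) := P.zeroSet ∪ P.starSet

instance (P : Pattern n m) : DecidablePred (· ∈ P.starSet) :=
  fun e => inferInstanceAs (Decidable (P e.1 e.2 = PatternSymbol.star))

/-- The set of realizations of a pattern: the complex matrices that vanish at the `0` entries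
and at the `?` entries. -/
def realizations (P : Pattern n m) : Set (Matrix (Fin n) (Fin m) ℂ) :=
  {M | ∀ i j, (i, j) ∈ P.zeroSet ∪ P.missingSet → M i j = 0}

/-- A realization is the same as a choice of a complex value for each `*` entry. -/
def realizationEquiv (P : Pattern n m) : (P.starSet → ℂ) ≃ P.realizations where
  toFun p := ⟨fun i j => if h : (i, j) ∈ P.starSet then p ⟨(i, j), h⟩ else 0, by
    intro i j hij
    have h : (i, j) ∉ P.starSet := by
      intro hs
      simp only [starSet, zeroSet, missingSet, Set.mem_union, Set.mem_ofPred_eq] at hs hij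
      rw [hs] at hij
      simp at hij
    exact dif_neg h⟩
  invFun M := fun e => M.1 e.1.1 e.1.2
  left_inv p := by
    funext e
    exact dif_pos e.2
  right_inv M := by
    apply Subtype.ext
    funext i j
    by_cases h : (i, j) ∈ P.starSet
    · exact dif_pos h
    · refine (dif_neg h).trans (M.2 i j ?_).symm
      simp only [starSet, zeroSet, missingSet, Set.mem_union, Set.mem_ofPred_eq] at h ⊢
      cases hP : P i j <;> simp_all

/-- A property holds for almost all realizations of `P` if the values of the `*` entries at which
it fails form a set of Lebesgue measure zero in the parameter space `ℂ^{n_*}`, where `n_*` is the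
number of `*` entries. -/
def ForAlmostAll (P : Pattern n m) (Q : P.realizations → Prop) : Prop :=
  ∀ᵐ p : P.starSet → ℂ, Q (P.realizationEquiv p)

end Pattern

/-- The low-rank matrix completion problem over a field `F`, with observed positions `Ω`, is
feasible: some matrix `X` over `F` agrees with `M` on `Ω` and has rank at most `n - k`
(a difference of integers). -/
def Feasible {F : Type*} [Field F] {n m : ℕ} (Ω : Set (Fin n × Fin m))
    (M : Matrix (Fin n) (Fin m) F) (k : ℕ) : Prop :=
  ∃ X : Matrix (Fin n) (Fin m) F,
    (∀ i j, (i, j) ∈ Ω → X i j = M i j) ∧ (X.rank : ℤ) ≤ (n : ℤ) - (k : ℤ)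

end LRMC

/-!
Feasibility is defined by algebraic conditions with no constants other than `0`, so it is invariant
under field automorphisms of `ℂ` applied to the `*` entries (`LRMC.Feasible.map`). The theorem
follows because almost all parameters lie in a single orbit of `Aut ℂ`:

* for almost every `p : ℂ^{n_*}` the coordinates of `p` are algebraically independent over `ℚ`,
  since there are only countably many nonzero polynomials over `ℚ` and the zero set of each is null
  (`AlgebraicIndependent.ae_of_countable`);
* two such points `p` and `q` are conjugate: extend both to transcendence bases of `ℂ`, which have
  the cardinality of the continuum, so that the bijection `p i ↦ q i` extends to a bijection of the
  bases, and then to an automorphism of the algebraically closed field `ℂ`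
  (`AlgebraicIndependent.exists_ringEquiv_apply_eq`).

So feasibility has the same truth value at almost all parameters. No elimination of
quantifiers (Chevalley's theorem) is needed. The two alternatives exclude each other
because Lebesgue measure is not zero.
-/

open MvPolynomial Cardinal

/-! ### Zero sets of polynomials are Lebesgue null -/

/-- By Fubini: where the leading coefficient in the first variable does not vanish, the first
variable is confined to finitely many roots. -/
theorem MvPolynomial.ae_eval_ne_zero_fin {n : ℕ} {q : MvPolynomial (Fin n) ℂ} (hq : q ≠ 0) :
    ∀ᵐ z : Fin n → ℂ, eval z q ≠ 0 := by
  induction n with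
  | zero =>
    obtain ⟨c, rfl⟩ := C_surjective (Fin 0) q
    have hc : c ≠ 0 := by rintro rfl; exact hq (map_zero _)
    simp [hc]
  | succ n ih =>
    have hq' : finSuccEquiv ℂ n q ≠ 0 := (EmbeddingLike.map_ne_zero_iff).2 hq
    have hpair : ∀ᵐ w : (Fin n → ℂ) × ℂ, eval (Fin.cons w.2 w.1 : Fin (n + 1) → ℂ) q ≠ 0 := by
      have hmeas : MeasurableSet
          {w : (Fin n → ℂ) × ℂ | eval (Fin.cons w.2 w.1 : Fin (n + 1) → ℂ) q ≠ 0} := by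
        refine IsOpen.measurableSet (isOpen_ne_fun ?_ continuous_const)
        exact (MvPolynomial.continuous_eval q).comp
          (Continuous.finCons continuous_snd continuous_fst)
      rw [Measure.volume_eq_prod, Measure.ae_prod_iff_ae_ae hmeas]
      filter_upwards [ih (Polynomial.leadingCoeff_ne_zero.2 hq')] with z hz
      have hz' : (finSuccEquiv ℂ n q).map (eval z) ≠ 0 := fun h => hz (by
        simpa using congrArg (Polynomial.coeff · (finSuccEquiv ℂ n q).natDegree) h)
      refine measure_mono_null (fun t ht => ?_)
        ((((finSuccEquiv ℂ n q).map (eval z)).rootSet_finite ℂ).measure_zero volume)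
      rw [Set.mem_compl_iff, Set.mem_ofPred_eq, not_not, eval_eq_eval_mv_eval'] at ht
      rw [Polynomial.mem_rootSet]
      exact ⟨hz', by simpa using ht⟩
    have hmp := (Measure.measurePreserving_swap (μ := (volume : Measure ℂ))
      (ν := (volume : Measure (Fin n → ℂ)))).comp
        (volume_preserving_piFinSuccAbove (fun _ : Fin (n + 1) => ℂ) 0)
    filter_upwards [hmp.quasiMeasurePreserving.ae hpair] with z hz
    convert hz
    exact (Fin.cons_self_tail z).symm

/-- A nonzero complex polynomial vanishes only on a Lebesgue null set. -/
theorem MvPolynomial.ae_eval_ne_zero {ι : Type*} [Fintype ι] {q : MvPolynomial ι ℂ} (hq : q ≠ 0) :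
    ∀ᵐ z : ι → ℂ, eval z q ≠ 0 := by
  let e := Fintype.equivFin ι
  have hq' : rename e q ≠ 0 := fun h => hq (rename_injective e e.injective (by simpa using h))
  have hmp := volume_measurePreserving_piCongrLeft (fun _ : Fin (Fintype.card ι) => ℂ) e
  filter_upwards [hmp.quasiMeasurePreserving.ae (ae_eval_ne_zero_fin hq')] with z hz
  rw [eval_rename] at hz
  convert hz
  funext i
  exact (MeasurableEquiv.piCongrLeft_apply_apply e (β := fun _ => ℂ) z i).symm

/-- Almost every complex vector has coordinates that are algebraically independent over a given
countable coefficient ring. -/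
theorem AlgebraicIndependent.ae_of_countable {ι : Type*} [Fintype ι] (R : Type*) [CommRing R]
    [Countable R] [Algebra R ℂ] [FaithfulSMul R ℂ] :
    ∀ᵐ z : ι → ℂ, AlgebraicIndependent R z := by
  have hcount : Countable (MvPolynomial ι R) := by
    rw [← Cardinal.mk_le_aleph0_iff]
    refine (MvPolynomial.cardinalMk_le_max_lift).trans ?_
    simp
  have key : ∀ᵐ z : ι → ℂ, ∀ q : MvPolynomial ι R, q ≠ 0 →
      eval z (q.map (algebraMap R ℂ)) ≠ 0 := by
    refine ae_all_iff.2 fun q => ?_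
    by_cases hq : q = 0
    · simp [hq]
    · have hq' : q.map (algebraMap R ℂ) ≠ 0 := fun h =>
        hq (map_injective _ (FaithfulSMul.algebraMap_injective R ℂ) (by simpa using h))
      filter_upwards [ae_eval_ne_zero hq'] with z hz _ using hz
  filter_upwards [key] with z hz
  rw [algebraicIndependent_iff]
  intro q hq
  by_contra h
  exact hz q h (by rwa [eval_map, ← aeval_def])

/-! ### Algebraically independent families are conjugate -/

/-- A bijection between two transcendence bases of an algebraically closed field is induced by an
automorphism of the field. -/
theorem IsTranscendenceBasis.exists_ringEquiv_apply_eq {R K ι κ : Type*} [CommRing R] [Field K]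
    [IsAlgClosed K] [Algebra R K] {v : ι → K} {w : κ → K} (hv : IsTranscendenceBasis R v)
    (hw : IsTranscendenceBasis R w) (e : ι ≃ κ) : ∃ σ : K ≃+* K, ∀ i, σ (v i) = w (e i) := by
  have := IsAlgClosed.isAlgClosure_of_transcendence_basis v hv
  have := IsAlgClosed.isAlgClosure_of_transcendence_basis w hw
  let f : Algebra.adjoin R (Set.range v) ≃ₐ[R] Algebra.adjoin R (Set.range w) :=
    (hv.1.aevalEquiv.symm.trans (renameEquiv R e)).trans hw.1.aevalEquiv
  refine ⟨IsAlgClosure.equivOfEquiv K K f.toRingEquiv, fun i => ?_⟩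
  have hvi : v i = algebraMap (Algebra.adjoin R (Set.range v)) K (hv.1.aevalEquiv (X i)) := by simp
  rw [hvi, IsAlgClosure.equivOfEquiv_algebraMap]
  simp [f]

/-- In an uncountable algebraically closed field, any two finite families that are algebraically
independent over a countable ring are conjugate under an automorphism of the field. -/
theorem AlgebraicIndependent.exists_ringEquiv_apply_eq {R K ι : Type*} [CommRing R] [Countable R]
    [Field K] [IsAlgClosed K] [Algebra R K] [Finite ι] (hK : ℵ₀ < #K)
    {x y : ι → K}
    (hx : AlgebraicIndependent R x) (hy : AlgebraicIndependent R y) :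
    ∃ σ : K ≃+* K, ∀ i, σ (x i) = y i := by
  have : Nontrivial R := RingHom.domain_nontrivial (algebraMap R K)
  obtain ⟨s, hxs, hs⟩ := exists_isTranscendenceBasis_superset hx.coe_range
  obtain ⟨t, hyt, ht⟩ := exists_isTranscendenceBasis_superset hy.coe_range
  have hR : #R ≤ ℵ₀ := mk_le_aleph0
  have hsK := lift_injective
    (IsAlgClosed.cardinal_eq_cardinal_transcendence_basis_of_aleph0_lt _ hs hR hK)
  have htK := lift_injective
    (IsAlgClosed.cardinal_eq_cardinal_transcendence_basis_of_aleph0_lt _ ht hR hK)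
  let x' : ι → s := fun i => ⟨x i, hxs ⟨i, rfl⟩⟩
  let y' : ι → t := fun i => ⟨y i, hyt ⟨i, rfl⟩⟩
  have hx' : Function.Injective x' := fun i j h => hx.injective (congrArg Subtype.val h)
  have hy' : Function.Injective y' := fun i j h => hy.injective (congrArg Subtype.val h)
  -- The domain of `x i ↦ y i` is finite and the bases are infinite of equal cardinality.
  obtain ⟨g, hg⟩ := extend_function_of_lt
    ((Equiv.ofInjective x' hx').symm.toEmbedding.trans ⟨y', hy'⟩)
    ((lt_aleph0_of_finite (Set.range x')).trans (hsK ▸ hK)) (Cardinal.eq.1 (hsK.symm.trans htK))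
  obtain ⟨σ, hσ⟩ := hs.exists_ringEquiv_apply_eq ht g
  refine ⟨σ, fun i => (hσ (x' i)).trans ?_⟩
  have := hg ⟨x' i, i, rfl⟩
  rw [this]
  simp [y', Equiv.ofInjective_symm_apply]

/-! ### Feasibility under field homomorphisms -/

/-- If `A = B * C` is a rank factorization, then `A.map f` factors through the same number of
columns. -/
theorem Matrix.rank_map_le_of_field {F K m n : Type*} [Field F] [Field K] [Fintype m] [Fintype n]
    (f : F →+* K) (A : Matrix m n F) : (A.map f).rank ≤ A.rank := by
  classical
  -- The columns of `B` form a basis of the column space of `A`.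
  let b := Module.finBasis F (LinearMap.range A.mulVecLin)
  let B : Matrix m (Fin A.rank) F := .of fun i l => (b l : m → F) i
  let C : Matrix (Fin A.rank) n F :=
    .of fun l j => b.repr ⟨A.mulVec (Pi.single j 1), Pi.single j 1, rfl⟩ l
  have hA : A = B * C := by
    ext i j
    have h := congrArg (fun v : LinearMap.range A.mulVecLin => (v : m → F) i)
      (b.sum_repr ⟨A.mulVec (Pi.single j 1), Pi.single j 1, rfl⟩)
    simp only [AddSubmonoidClass.coe_finsetSum, Submodule.coe_smul, Finset.sum_apply,
      Pi.smul_apply, smul_eq_mul, Matrix.mulVec_single_one, Matrix.col_apply] at h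
    rw [← h, Matrix.mul_apply]
    refine Finset.sum_congr rfl fun l _ => ?_
    simp only [B, C, Matrix.mulVec_single_one]
    exact mul_comm _ _
  calc (A.map f).rank = (B.map f * C.map f).rank := by rw [← Matrix.map_mul, ← hA]
    _ ≤ (B.map f).rank := Matrix.rank_mul_le_left _ _
    _ ≤ A.rank := by simpa using (B.map f).rank_le_card_width

namespace LRMC

theorem Feasible.map {F K : Type*} [Field F] [Field K] {n m : ℕ} {Ω : Set (Fin n × Fin m)}
    {M : Matrix (Fin n) (Fin m) F} {k : ℕ} (h : Feasible Ω M k) (f : F →+* K) :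
    Feasible Ω (M.map f) k := by
  obtain ⟨X, hX, hr⟩ := h
  refine ⟨X.map f, fun i j hij => by simp [hX i j hij], le_trans ?_ hr⟩
  exact_mod_cast X.rank_map_le_of_field f

theorem Pattern.realizationEquiv_map {n m : ℕ} (P : Pattern n m) (p : P.starSet → ℂ)
    (f : ℂ →+* ℂ) :
    ((P.realizationEquiv p).1.map f) = (P.realizationEquiv fun e => f (p e)).1 := by
  ext i j
  change f (if h : (i, j) ∈ P.starSet then p ⟨(i, j), h⟩ else 0) =
    if h : (i, j) ∈ P.starSet then f (p ⟨(i, j), h⟩) else 0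
  split_ifs
  · rfl
  · exact map_zero f

/-- Feasibility does not depend on which algebraically independent values are put at the `*`
entries. -/
theorem feasible_of_algebraicIndependent {n m k : ℕ} (P : Pattern n m) {p q : P.starSet → ℂ}
    (hp : AlgebraicIndependent ℚ p) (hq : AlgebraicIndependent ℚ q)
    (h : Feasible P.observedSet (P.realizationEquiv p).1 k) :
    Feasible P.observedSet (P.realizationEquiv q).1 k := by
  obtain ⟨σ, hσ⟩ := hp.exists_ringEquiv_apply_eq
    (by rw [mk_complex]; exact aleph0_lt_continuum) hq
  have h' := h.map (σ : ℂ →+* ℂ)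
  rw [P.realizationEquiv_map] at h'
  convert h' using 4
  exact (hσ _).symm

end LRMC

theorem theorem1 (n m : ℕ) (P : LRMC.Pattern n m) (k : ℕ) :
    Xor
      (P.ForAlmostAll fun M => LRMC.Feasible P.observedSet M.1 k)
      (P.ForAlmostAll fun M => ¬ LRMC.Feasible P.observedSet M.1 k) := by
  have hgen : ∀ᵐ p : P.starSet → ℂ, AlgebraicIndependent ℚ p :=
    AlgebraicIndependent.ae_of_countable ℚ
  -- Both alternatives at once would make the whole parameter space null.
  have hnot : ¬ ((P.ForAlmostAll fun M => LRMC.Feasible P.observedSet M.1 k) ∧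
      P.ForAlmostAll fun M => ¬ LRMC.Feasible P.observedSet M.1 k) := by
    rintro ⟨h₁, h₂⟩
    obtain ⟨p, hp₁, hp₂⟩ := (Filter.Eventually.and h₁ h₂).exists
    exact hp₂ hp₁
  rw [xor_iff_or_and_not_and]
  refine ⟨?_, hnot⟩
  obtain ⟨p, hp⟩ := hgen.exists
  by_cases hf : LRMC.Feasible P.observedSet (P.realizationEquiv p).1 k
  · left
    filter_upwards [hgen] with q hq using LRMC.feasible_of_algebraicIndependent P hp hq hf
  · right
    filter_upwards [hgen] with q hq h
    exact hf (LRMC.feasible_of_algebraicIndependent P hq hp h)
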